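/- For positive integers $n\ge 2k$, let $KG_{n,k}$ be the Kneser graph, whose vertices are the $k$-element subsets of $[n]=\{1,\dots,n\}$, two of them being adjacent when they are disjoint. A family of sets is intersecting if any two of its members intersect; it is a star (or trivial) if some fixed element of $[n]$ lies in all of its members, and non-trivial otherwise. Let $n(k)$ be the largest $n\ge 2k$ such that $KG_{n,k}$ has a proper coloring with $n-2k+2$ colors in which no color class is a star. There is an integer $k_0\ge 2$ such that the following holds for every integer $k\ge k_0$, with $\varepsilon=3/\ln k$. For every integer $n\ge(2+\varepsilon)k^2$, the collection $\binom{[n]}{k}$ of all $k$-element subsets of $[n]$ cannot be covered by $n$ non-trivial intersecting families of $k$-element subsets of $[n]$. Moreover, the number $n(k)$ exists and $n(k)<(2+\varepsilon)k^2$. -/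

import Mathlib

/-- A family `F` of finite sets is a star (or trivial) if some fixed element, a center, lies in all
members of `F`. In particular the empty family on a nonempty ground set is a star. -/
def IsStar {X : Type*} (F : Set (Finset X)) : Prop :=
  ∃ i : X, ∀ A ∈ F, i ∈ A

/-- A non-trivial intersecting family of `k`-element subsets of `X`. -/
structure IsNontrivialIntersecting {X : Type*} [DecidableEq X] (k : ℕ)
    (F : Set (Finset X)) : Prop where
  sized : F ⊆ Set.powersetCard X k
  intersecting : ∀ A ∈ F, ∀ B ∈ F, (A ∩ B).Nonempty
  not_isStar : ¬ IsStar F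

/-- The Kneser graph: its vertices are the `k`-element subsets of an `n`-element set, and distinct
vertices are adjacent if they are disjoint. (For `k ≥ 1`, disjoint `k`-sets are distinct.) -/
def kneserGraph (n k : ℕ) : SimpleGraph (Set.powersetCard (Fin n) k) where
  Adj A B := A ≠ B ∧ Disjoint (A : Finset (Fin n)) (B : Finset (Fin n))
  symm := ⟨fun _ _ h => ⟨h.1.symm, h.2.symm⟩⟩
  loopless := ⟨fun _ h => h.1 rfl⟩

/-- The family of `k`-sets which receive the color `c`. -/
def colorFamily {n k : ℕ} {α : Type*} (C : (kneserGraph n k).Coloring α) (c : α) :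
    Set (Finset (Fin n)) :=
  (fun A : Set.powersetCard (Fin n) k => (A : Finset (Fin n))) '' C.colorClass c

/-- The set of all `n ≥ 2k` for which the Kneser graph has a proper coloring with `n - 2k + 2`
colors, none of which is a star. -/
def starFreeSizes (k : ℕ) : Set ℕ :=
  {n | 2 * k ≤ n ∧ ∃ C : (kneserGraph n k).Coloring (Fin (n - 2 * k + 2)),
    ∀ c, ¬ IsStar (colorFamily C c)}

/-- The number `n(k)`: the largest element of `starFreeSizes k`. -/
noncomputable def starFreeNumber (k : ℕ) : ℕ :=
  sSup (starFreeSizes k)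

/-! Take a random set `W` of density `p`, about `(ln k)/k`, and find in it a `k`-set that lies in
none of the given families.

The structural input (`IsNontrivialIntersecting.exists_cover`) is that every member of a non-trivial
intersecting family contains one of at most `k` pairs `{x, b}`, or a set from a collection whose
expected number inside `W` is at most `3 (p/q)^2`, where `q = coverDensity k` has order `k^(-1/3)`.
The pairs join a centre `x` to the points of a member missing `x`. Over `n` families the pairs form
a graph with at most `nk` edges, so `W` spans about `np` vertices with average degree at most about
`2kp`. The other sets cost `n * O(k^(-4/3) (ln k)^2)` vertices, negligible against `np`. Turán's
bound then leaves about `np / (1 + 2kp)` independent vertices. This is at least `k` once `n` exceeds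
`(2 + 1/(kp)) k^2`, up to the error from the cheap covers. Since `kp ≥ ln k`, the slack `3 / ln k`
suffices.

The structure comes from a dichotomy: of two cross-intersecting families, one has a cover of cost 1
at density `q` (`isCheap_or_isCheap_of_cross_intersecting`). It is proved by exposing three random
color classes in turn and counting minimal fragments. -/

/-! ### Turán's bound in a form that can be averaged -/

/-- A quantitative form of Turán's theorem for independent sets, linear in the number of vertices
and in the number of adjacent ordered pairs. -/
theorem exists_independent_subset {V : Type*} [DecidableEq V] (r : V → V → Prop)
    [DecidableRel r] (hr : ∀ u v, r u v → r v u) (hi : ∀ v, ¬ r v v) (D : ℝ) (W : Finset V) :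
    ∃ I ⊆ W, (∀ u ∈ I, ∀ v ∈ I, ¬ r u v) ∧
      (1 + 2 * D) * W.card - (∑ u ∈ W, ((W.filter (r u)).card : ℝ)) ≤ (1 + D) ^ 2 * I.card := by
  induction W using Finset.strongInduction with
  | H W ih =>
    rcases W.eq_empty_or_nonempty with rfl | hW
    · exact ⟨∅, by simp⟩
    -- Greedy choice: keep a vertex of minimum degree `δ` and discard its neighbours. The `δ + 1`
    -- removed vertices carry degree sum at least `δ (δ + 1)`.
    obtain ⟨v, hv, hmin⟩ := W.exists_min_image (fun u => (W.filter (r u)).card) hW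
    set N := insert v (W.filter (r v)) with hN
    have hvN : v ∉ W.filter (r v) := by simp [hi]
    have hNW : N ⊆ W := Finset.insert_subset hv (Finset.filter_subset _ _)
    have hssub : W \ N ⊂ W := Finset.sdiff_ssubset hNW ⟨v, by simp [hN]⟩
    obtain ⟨I, hI, hind, hcard⟩ := ih (W \ N) hssub
    have hvI : v ∉ I := fun h => (Finset.mem_sdiff.1 (hI h)).2 (by simp [hN])
    have hrv : ∀ u ∈ I, ¬ r v u := fun u hu h => by
      have h1 := Finset.mem_sdiff.1 (hI hu)
      exact h1.2 (Finset.mem_insert_of_mem (Finset.mem_filter.2 ⟨h1.1, h⟩))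
    refine ⟨insert v I, Finset.insert_subset hv (hI.trans hssub.1), ?_, ?_⟩
    · intro a ha b hb hab
      rcases Finset.mem_insert.1 ha with ha' | ha' <;>
        rcases Finset.mem_insert.1 hb with hb' | hb'
      · rw [ha', hb'] at hab
        exact hi v hab
      · exact hrv b hb' (ha' ▸ hab)
      · exact hrv a ha' (hr _ _ (hb' ▸ hab))
      · exact hind a ha' b hb' hab
    set δ : ℝ := ((W.filter (r v)).card : ℝ) with hδ
    have hNc : (N.card : ℝ) = δ + 1 := by
      rw [hN, Finset.card_insert_of_notMem hvN]; push_cast; rfl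
    have hWN : ((W \ N).card : ℝ) = W.card - (δ + 1) := by
      rw [Finset.card_sdiff_of_subset hNW, Nat.cast_sub (Finset.card_le_card hNW), hNc]
    have h1 : (∑ u ∈ W, ((W.filter (r u)).card : ℝ)) =
        (∑ u ∈ W \ N, ((W.filter (r u)).card : ℝ)) + ∑ u ∈ N, ((W.filter (r u)).card : ℝ) :=
      (Finset.sum_sdiff hNW).symm
    have h2 : (∑ u ∈ W \ N, (((W \ N).filter (r u)).card : ℝ)) ≤
        ∑ u ∈ W \ N, ((W.filter (r u)).card : ℝ) :=
      Finset.sum_le_sum fun u _ => by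
        exact_mod_cast Finset.card_le_card (Finset.filter_subset_filter _ hssub.1)
    have h3 : (δ + 1) * δ ≤ ∑ u ∈ N, ((W.filter (r u)).card : ℝ) := by
      rw [← hNc, ← nsmul_eq_mul]
      exact Finset.card_nsmul_le_sum _ _ _ fun u hu => by
        exact Nat.cast_le.2 (hmin u (hNW hu))
    rw [Finset.card_insert_of_notMem hvI]
    push_cast
    rw [hWN] at hcard
    -- The left side drops by at most `(δ + 1) (1 + 2D - δ) = (1 + D)^2 - (D - δ)^2`.
    nlinarith [sq_nonneg (D - δ)]

/-! ### Minimal fragments relative to a random color class -/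

section Fragments

variable {V : Type*} [DecidableEq V]

open Classical in
/-- The inclusion-minimal sets among the differences `S \ W` with `S ∈ H`. -/
noncomputable def fragments (H : Finset (Finset V)) (W : Finset V) : Finset (Finset V) :=
  (H.image (· \ W)).filter (Minimal (· ∈ H.image (· \ W)))

theorem exists_eq_sdiff_of_mem_fragments {H : Finset (Finset V)} {W T : Finset V}
    (hT : T ∈ fragments H W) : ∃ S ∈ H, S \ W = T := by
  classical
  exact Finset.mem_image.1 (Finset.mem_filter.1 hT).1

theorem exists_fragment_subset {H : Finset (Finset V)} (W : Finset V) {S : Finset V}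
    (hS : S ∈ H) : ∃ T ∈ fragments H W, T ⊆ S := by
  classical
  obtain ⟨T, hTS, hT⟩ :=
    Finset.exists_le_minimal (H.image (· \ W)) (Finset.mem_image_of_mem (· \ W) hS)
  exact ⟨T, Finset.mem_filter.2 ⟨hT.prop, hT⟩, hTS.trans Finset.sdiff_subset⟩

theorem sdiff_eq_of_mem_fragments {H : Finset (Finset V)} {W T S : Finset V}
    (hT : T ∈ fragments H W) (hS : S ∈ H) (h : S ⊆ W ∪ T) : S \ W = T := by
  classical
  have hm := (Finset.mem_filter.1 hT).2
  have hsub : S \ W ⊆ T := fun a ha => by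
    have := Finset.mem_sdiff.1 ha
    exact (Finset.mem_union.1 (h this.1)).resolve_left this.2
  exact subset_antisymm hsub (hm.2 (Finset.mem_image_of_mem (· \ W) hS) hsub)

variable [Fintype V] {κ : Type*} [Fintype κ] [DecidableEq κ]

/-- The set of points of color `c`. -/
def colorSet (ω : V → κ) (c : κ) : Finset V := Finset.univ.filter fun v => ω v = c

/-- The coloring obtained from `ω` by giving all points of `T` the color `c`. -/
def recolor (ω : V → κ) (T : Finset V) (c : κ) : V → κ := fun v => if v ∈ T then c else ω v

/-- Off `T` the original coloring can be read off the new one, so only its values on `T` are lost.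
-/
theorem card_recolor_fiber_le (T : Finset V) (c : κ) (ω' : V → κ) :
    (Finset.univ.filter fun ω : V → κ => recolor ω T c = ω').card ≤
      Fintype.card κ ^ T.card := by
  have h : Fintype.card (T → κ) = Fintype.card κ ^ T.card := by simp
  rw [← h, ← Finset.card_univ]
  refine Finset.card_le_card_of_injOn (fun ω v => ω v)
    (fun _ _ => Finset.mem_coe.2 (Finset.mem_univ _)) ?_
  intro ω₁ h₁ ω₂ h₂ heq
  have h₁ : recolor ω₁ T c = ω' := by simpa using h₁
  have h₂ : recolor ω₂ T c = ω' := by simpa using h₂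
  funext v
  by_cases hv : v ∈ T
  · exact congrFun heq ⟨v, hv⟩
  · have := congrFun (h₁.trans h₂.symm) v
    simpa [recolor, hv] using this

/-- In a random coloring, the expected weight of the fragments with respect to a color class is
small, also if the family itself depends on the classes of other colors. -/
theorem sum_fragments_le (c : κ) (B : Finset κ) (hc : c ∉ B)
    (H : (V → κ) → Finset (Finset V))
    (hH : ∀ ω ω' : V → κ, (∀ v, ∀ b ∈ B, ω v = b ↔ ω' v = b) → H ω = H ω')
    (hB : ∀ ω, ∀ S ∈ H ω, ∀ v ∈ S, ω v ∉ B) {ℓ x : ℝ} (hx : 0 ≤ x) (hℓ : 0 ≤ ℓ)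
    (hcard : ∀ ω, ∀ S ∈ H ω, (S.card : ℝ) ≤ ℓ) :
    ∑ ω : V → κ, ∑ T ∈ fragments (H ω) (colorSet ω c), x ^ T.card ≤
      Fintype.card (V → κ) * Real.exp (Fintype.card κ * x * ℓ) := by
  classical
  -- `R ω` is a fixed member of `H ω` inside the class of `c`; the value `∅` is a default when there
  -- is none.
  have hex : ∀ ω : V → κ, ∃ R : Finset V, (R.card : ℝ) ≤ ℓ ∧
      ((∃ S ∈ H ω, S ⊆ colorSet ω c) → R ∈ H ω ∧ R ⊆ colorSet ω c) := by
    intro ω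
    by_cases h : ∃ S ∈ H ω, S ⊆ colorSet ω c
    · obtain ⟨S, hS, hS'⟩ := h
      exact ⟨S, hcard ω S hS, fun _ => ⟨hS, hS'⟩⟩
    · exact ⟨∅, by simpa using hℓ, fun h' => absurd h' h⟩
  choose R hR hR' using hex
  -- Recoloring `T` by `c` leaves the family unchanged and puts some member inside the class, so `R`
  -- is a member inside `W ∪ T`. Minimality of the fragment forces `R \ W = T`. Thus the pair `(ω,
  -- T)` is encoded by the new coloring, a subset of its `R`, and the old colors on `T`.
  have key : ∀ ω T, T ∈ fragments (H ω) (colorSet ω c) → T ⊆ R (recolor ω T c) := by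
    intro ω T hT
    obtain ⟨S, hS, hST⟩ := exists_eq_sdiff_of_mem_fragments hT
    have hTB : ∀ v ∈ T, ω v ∉ B := fun v hv =>
      hB ω S hS v (Finset.sdiff_subset (hST.symm ▸ hv : v ∈ S \ colorSet ω c))
    have heq : H ω = H (recolor ω T c) := by
      refine hH _ _ fun v b hb => ?_
      by_cases hv : v ∈ T
      · simp only [recolor, hv, if_true]
        exact ⟨fun h => absurd (h ▸ hb) (hTB v hv), fun h => absurd (h ▸ hb) hc⟩
      · simp [recolor, hv]
    have hcs : colorSet (recolor ω T c) c = colorSet ω c ∪ T := by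
      ext v
      by_cases hv : v ∈ T <;> simp [colorSet, recolor, hv]
    obtain ⟨h1, h2⟩ := hR' (recolor ω T c) ⟨S, heq ▸ hS, by
      rw [hcs, ← hST]
      intro a ha
      by_cases h : a ∈ colorSet ω c <;> simp [h, ha]⟩
    rw [← heq] at h1
    rw [hcs] at h2
    have := sdiff_eq_of_mem_fragments hT h1 h2
    exact fun a ha => Finset.sdiff_subset (this.symm ▸ ha : a ∈ R (recolor ω T c) \ colorSet ω c)
  calc ∑ ω : V → κ, ∑ T ∈ fragments (H ω) (colorSet ω c), x ^ T.card
      ≤ ∑ ω : V → κ, ∑ T : Finset V, if T ⊆ R (recolor ω T c) then x ^ T.card else 0 := by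
        refine Finset.sum_le_sum fun ω _ => ?_
        rw [← Finset.sum_filter]
        exact Finset.sum_le_sum_of_subset_of_nonneg
          (fun T hT => Finset.mem_filter.2 ⟨Finset.mem_univ _, key ω T hT⟩)
          fun _ _ _ => by positivity
    _ = ∑ T : Finset V, ∑ ω' : V → κ,
          ∑ ω ∈ Finset.univ.filter (fun ω : V → κ => recolor ω T c = ω'),
            if T ⊆ R (recolor ω T c) then x ^ T.card else 0 := by
        rw [Finset.sum_comm]
        exact Finset.sum_congr rfl fun T _ => (Finset.sum_fiberwise _ _ _).symm
    _ ≤ ∑ T : Finset V, ∑ ω' : V → κ,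
          if T ⊆ R ω' then ((Fintype.card κ : ℝ) * x) ^ T.card else 0 := by
        refine Finset.sum_le_sum fun T _ => Finset.sum_le_sum fun ω' _ => ?_
        have : ∀ ω ∈ Finset.univ.filter (fun ω : V → κ => recolor ω T c = ω'),
            (if T ⊆ R (recolor ω T c) then x ^ T.card else 0) =
              if T ⊆ R ω' then x ^ T.card else 0 := fun ω hω => by
          rw [(Finset.mem_filter.1 hω).2]
        rw [Finset.sum_congr rfl this, Finset.sum_const, nsmul_eq_mul]
        split_ifs
        · rw [mul_pow]
          gcongr
          exact_mod_cast card_recolor_fiber_le T c ω'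
        · simp
    _ = ∑ ω' : V → κ, ∑ T ∈ (R ω').powerset, ((Fintype.card κ : ℝ) * x) ^ T.card := by
        rw [Finset.sum_comm]
        refine Finset.sum_congr rfl fun ω' _ => ?_
        rw [← Finset.sum_filter]
        congr 1
        ext T
        simp
    _ ≤ ∑ _ω' : V → κ, Real.exp (Fintype.card κ * x * ℓ) := by
        refine Finset.sum_le_sum fun ω' _ => ?_
        have h1 := Finset.sum_pow_mul_eq_add_pow ((Fintype.card κ : ℝ) * x) 1 (R ω')
        simp only [one_pow, mul_one] at h1
        rw [h1]
        calc ((Fintype.card κ : ℝ) * x + 1) ^ (R ω').card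
            ≤ Real.exp (Fintype.card κ * x) ^ (R ω').card := by
              gcongr
              exact Real.add_one_le_exp _
          _ = Real.exp (Fintype.card κ * x * (R ω').card) := by
              rw [← Real.exp_nat_mul, mul_comm]
          _ ≤ _ := by
              gcongr
              exact hR ω'
    _ = _ := by simp

/-- The expected weight of the fragments with at least `t` elements. -/
theorem sum_large_fragments_le (c : κ) (B : Finset κ) (hc : c ∉ B)
    (H : (V → κ) → Finset (Finset V))
    (hH : ∀ ω ω' : V → κ, (∀ v, ∀ b ∈ B, ω v = b ↔ ω' v = b) → H ω = H ω')
    (hB : ∀ ω, ∀ S ∈ H ω, ∀ v ∈ S, ω v ∉ B) {ℓ q t : ℝ} (hq : 0 ≤ q) (ht : 1 ≤ t)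
    (hcard : ∀ ω, ∀ S ∈ H ω, (S.card : ℝ) ≤ ℓ) (hℓ : 0 ≤ ℓ)
    (hqt : Fintype.card κ * (Real.exp 3 * q) * ℓ = t) :
    ∑ ω : V → κ, ∑ T ∈ (fragments (H ω) (colorSet ω c)).filter (fun T => t ≤ (T.card : ℝ)),
        q ^ T.card ≤ Fintype.card (V → κ) * Real.exp (-2) := by
  have h := sum_fragments_le c B hc H hH hB (x := Real.exp 3 * q) (by positivity) hℓ hcard
  rw [hqt] at h
  have h' : ∑ ω : V → κ, ∑ T ∈ (fragments (H ω) (colorSet ω c)).filter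
        (fun T => t ≤ (T.card : ℝ)), q ^ T.card ≤
      Real.exp (-3 * t) * ∑ ω : V → κ, ∑ T ∈ fragments (H ω) (colorSet ω c),
        (Real.exp 3 * q) ^ T.card := by
    -- Replacing the weight base `exp 3 * q` by `q` gains `exp (-3 |T|) ≤ exp (-3 t)`, against a
    -- total of `exp t`.
    simp only [Finset.mul_sum]
    refine Finset.sum_le_sum fun ω _ => ?_
    rw [Finset.sum_filter]
    refine Finset.sum_le_sum fun T _ => ?_
    split_ifs with hT
    · rw [mul_pow, ← Real.exp_nat_mul, ← mul_assoc, ← Real.exp_add]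
      refine le_mul_of_one_le_left (by positivity) (Real.one_le_exp ?_)
      linarith
    · positivity
  refine h'.trans ((mul_le_mul_of_nonneg_left h (Real.exp_pos _).le).trans ?_)
  rw [mul_left_comm, ← Real.exp_add]
  gcongr
  linarith

end Fragments

/-! ### Cheap covers and the cross-intersecting dichotomy -/

section Cheap

variable {V : Type*}

/-- Every member of `F` contains one of finitely many nonempty sets, for which the expected number
of those contained in a random set of density `p` is at most `η`. -/
def IsCheap (p η : ℝ) (F : Set (Finset V)) : Prop :=
  ∃ 𝒢 : Finset (Finset V), (∀ T ∈ 𝒢, T.Nonempty) ∧ (∀ A ∈ F, ∃ T ∈ 𝒢, T ⊆ A) ∧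
    ∑ T ∈ 𝒢, p ^ T.card ≤ η

theorem IsCheap.mono {p η η' : ℝ} {F F' : Set (Finset V)} (h : IsCheap p η F) (hF : F' ⊆ F)
    (hη : η ≤ η') : IsCheap p η' F' := by
  obtain ⟨𝒢, h1, h2, h3⟩ := h
  exact ⟨𝒢, h1, fun A hA => h2 A (hF hA), h3.trans hη⟩

theorem sum_union_le_add {α : Type*} [DecidableEq α] (s t : Finset α) {f : α → ℝ}
    (hf : ∀ a, 0 ≤ f a) : ∑ a ∈ s ∪ t, f a ≤ ∑ a ∈ s, f a + ∑ a ∈ t, f a := by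
  rw [← Finset.sum_union_inter]
  exact le_add_of_nonneg_right (Finset.sum_nonneg fun a _ => hf a)

theorem exists_mem_le_one_of_sum_le_card {α : Type*} [Fintype α] {f : α → ℝ} (Ω : Finset α)
    (hΩ : Ω.Nonempty) (hf : ∀ a, 0 ≤ f a) (h : ∑ a, f a ≤ Ω.card) : ∃ a ∈ Ω, f a ≤ 1 := by
  refine Finset.exists_le_of_sum_le hΩ ?_
  calc ∑ a ∈ Ω, f a ≤ ∑ a, f a :=
        Finset.sum_le_sum_of_subset_of_nonneg (Finset.subset_univ _) fun a _ _ => hf a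
    _ ≤ ∑ _a ∈ Ω, (1 : ℝ) := by simpa using h

variable [DecidableEq V]

theorem sum_biUnion_le_card_mul {ι α : Type*} [DecidableEq α] (X : Finset ι) (G : ι → Finset α)
    {f : α → ℝ} (hf : ∀ a, 0 ≤ f a) {η : ℝ} (h : ∀ x ∈ X, ∑ a ∈ G x, f a ≤ η) :
    ∑ a ∈ X.biUnion G, f a ≤ X.card * η := by
  classical
  induction X using Finset.induction_on with
  | empty => simp
  | insert x X hx ih =>
    have h1 := h x (Finset.mem_insert_self _ _)
    have h2 := ih fun y hy => h y (Finset.mem_insert_of_mem hy)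
    rw [Finset.biUnion_insert, Finset.card_insert_of_notMem hx]
    refine (sum_union_le_add _ _ hf).trans ((add_le_add h1 h2).trans (le_of_eq ?_))
    push_cast
    ring

theorem IsCheap.union {p η η' : ℝ} (hp : 0 ≤ p) {F F' : Set (Finset V)} (h : IsCheap p η F)
    (h' : IsCheap p η' F') : IsCheap p (η + η') (F ∪ F') := by
  obtain ⟨𝒢, h1, h2, h3⟩ := h
  obtain ⟨𝒢', h1', h2', h3'⟩ := h'
  refine ⟨𝒢 ∪ 𝒢', fun T hT => (Finset.mem_union.1 hT).elim (h1 T) (h1' T), ?_, ?_⟩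
  · rintro A (hA | hA)
    · obtain ⟨T, hT, hTA⟩ := h2 A hA
      exact ⟨T, Finset.mem_union_left _ hT, hTA⟩
    · obtain ⟨T, hT, hTA⟩ := h2' A hA
      exact ⟨T, Finset.mem_union_right _ hT, hTA⟩
  · exact (sum_union_le_add _ _ fun T => by positivity).trans (add_le_add h3 h3')

theorem IsCheap.biUnion {p η : ℝ} (hp : 0 ≤ p) {ι : Type*} (X : Finset ι)
    {F : ι → Set (Finset V)} (h : ∀ x ∈ X, IsCheap p η (F x)) :
    IsCheap p (X.card * η) (⋃ x ∈ X, F x) := by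
  choose! 𝒢 h1 h2 h3 using h
  refine ⟨X.biUnion 𝒢, fun T hT => ?_, fun A hA => ?_,
    sum_biUnion_le_card_mul X 𝒢 (fun T => by positivity) h3⟩
  · obtain ⟨x, hx, hT⟩ := Finset.mem_biUnion.1 hT
    exact h1 x hx T hT
  · obtain ⟨x, hx, hA⟩ := Set.mem_iUnion₂.1 hA
    obtain ⟨T, hT, hTA⟩ := h2 x hx A hA
    exact ⟨T, Finset.mem_biUnion.2 ⟨x, hx, hT⟩, hTA⟩

/-- Members of a family which share a point are cheaper than their traces off that point. -/
theorem IsCheap.of_erase {p q : ℝ} (hp : 0 ≤ p) (hq : 0 < q) (hpq : p ≤ q) (x : V)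
    {F : Set (Finset V)} (hx : ∀ A ∈ F, x ∈ A)
    (h : IsCheap q 1 ((fun A : Finset V => A.erase x) '' F)) : IsCheap p (p * (p / q)) F := by
  obtain ⟨𝒢, h1, h2, h3⟩ := h
  have hr : p / q ≤ 1 := (div_le_one hq).2 hpq
  -- Only sets avoiding `x` can lie in a trace off `x`. Adding `x` gives a factor `p`, and
  -- nonemptiness of the set gives a further `p / q`.
  refine ⟨(𝒢.filter (x ∉ ·)).image (insert x), ?_, ?_, ?_⟩
  · intro T hT
    obtain ⟨S, -, rfl⟩ := Finset.mem_image.1 hT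
    exact Finset.insert_nonempty _ _
  · intro A hA
    obtain ⟨T, hT, hTA⟩ := h2 _ (Set.mem_image_of_mem _ hA)
    refine ⟨insert x T, Finset.mem_image_of_mem _ (Finset.mem_filter.2 ⟨hT, fun h => ?_⟩), ?_⟩
    · exact Finset.notMem_erase x A (hTA h)
    · exact Finset.insert_subset (hx A hA) (hTA.trans (Finset.erase_subset _ _))
  · rw [Finset.sum_image]
    · calc ∑ T ∈ 𝒢.filter (x ∉ ·), p ^ (insert x T).card
          ≤ ∑ T ∈ 𝒢.filter (x ∉ ·), p * (p / q) * q ^ T.card := by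
            refine Finset.sum_le_sum fun T hT => ?_
            obtain ⟨hT, hxT⟩ := Finset.mem_filter.1 hT
            rw [Finset.card_insert_of_notMem hxT]
            have : p ^ T.card ≤ (p / q) * q ^ T.card := by
              calc p ^ T.card = (p / q) ^ T.card * q ^ T.card := by
                    rw [← mul_pow, div_mul_cancel₀ _ hq.ne']
                _ ≤ _ := by
                    gcongr
                    exact pow_le_of_le_one (by positivity) hr (h1 T hT).card_pos.ne'
            rw [pow_succ', mul_assoc]
            gcongr
        _ ≤ ∑ T ∈ 𝒢, p * (p / q) * q ^ T.card :=
            Finset.sum_le_sum_of_subset_of_nonneg (Finset.filter_subset _ _)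
              fun _ _ _ => by positivity
        _ ≤ p * (p / q) := by
            rw [← Finset.mul_sum]
            exact mul_le_of_le_one_right (by positivity) h3
    · intro S hS T hT h
      have hS := (Finset.mem_filter.1 hS).2
      have hT := (Finset.mem_filter.1 hT).2
      rw [← Finset.erase_insert hS, ← Finset.erase_insert hT]
      exact congrArg (fun A : Finset V => A.erase x) h

variable [Fintype V] {κ : Type*} [Fintype κ] [DecidableEq κ]

set_option maxHeartbeats 1000000 in
/-- If the union of three random color classes often contains no member of `H`, then `H` has a
cheap cover. -/
theorem isCheap_of_rarely_contained (H : Finset (Finset V)) {ℓ s : ℝ} (hs : 0 < s) (hs1 : s ≤ 1)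
    (hsℓ : s ^ 3 * ℓ = 1) (hcard : ∀ S ∈ H, (S.card : ℝ) ≤ ℓ) {c₁ c₂ c₃ : κ} (h₁₂ : c₁ ≠ c₂)
    (h₁₃ : c₁ ≠ c₃) (h₂₃ : c₂ ≠ c₃)
    (hrare : Fintype.card (V → κ) ≤ 2 * (Finset.univ.filter fun ω : V → κ =>
      ∀ S ∈ H, ¬ S ⊆ colorSet ω c₁ ∪ colorSet ω c₂ ∪ colorSet ω c₃).card) :
    IsCheap (s / (Fintype.card κ * Real.exp 3)) 1 (H : Set (Finset V)) := by
  classical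
  have hκ : (0 : ℝ) < Fintype.card κ := by
    have : Nonempty κ := ⟨c₁⟩
    exact_mod_cast Fintype.card_pos
  set q : ℝ := s / (Fintype.card κ * Real.exp 3) with hqdef
  have hq : 0 < q := by positivity
  have hqs : Fintype.card κ * (Real.exp 3 * q) = s := by
    rw [hqdef]; field_simp
  have hℓ : 0 < ℓ := by
    by_contra h
    have : s ^ 3 * ℓ ≤ 0 := mul_nonpos_of_nonneg_of_nonpos (by positivity) (not_lt.1 h)
    linarith
  have ht3 : s * (s * (s * ℓ)) = 1 := by rw [← hsℓ]; ring
  have ht2 : 1 ≤ s * (s * ℓ) := by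
    rw [← ht3]; exact mul_le_of_le_one_left (by positivity) hs1
  have ht1 : 1 ≤ s * ℓ := ht2.trans (mul_le_of_le_one_left (by positivity) hs1)
  -- Three rounds of exposure: large fragments go to the cover, small ones form the next family. The
  -- size bound shrinks by `s` each time, from `ℓ` to `s ^ 3 * ℓ = 1`.
  let A₁ : (V → κ) → Finset (Finset V) := fun ω => fragments H (colorSet ω c₁)
  let H₂ : (V → κ) → Finset (Finset V) := fun ω =>
    (A₁ ω).filter fun T => (T.card : ℝ) < s * ℓ
  let A₂ : (V → κ) → Finset (Finset V) := fun ω => fragments (H₂ ω) (colorSet ω c₂)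
  let H₃ : (V → κ) → Finset (Finset V) := fun ω =>
    (A₂ ω).filter fun T => (T.card : ℝ) < s * (s * ℓ)
  let A₃ : (V → κ) → Finset (Finset V) := fun ω => fragments (H₃ ω) (colorSet ω c₃)
  let G₁ : (V → κ) → Finset (Finset V) := fun ω =>
    (A₁ ω).filter fun T => s * ℓ ≤ (T.card : ℝ)
  let G₂ : (V → κ) → Finset (Finset V) := fun ω =>
    (A₂ ω).filter fun T => s * (s * ℓ) ≤ (T.card : ℝ)
  let G₃ : (V → κ) → Finset (Finset V) := fun ω =>
    (A₃ ω).filter fun T => (1 : ℝ) ≤ (T.card : ℝ)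
  have hcol : ∀ {ω ω' : V → κ} {b : κ}, (∀ v, ω v = b ↔ ω' v = b) →
      colorSet ω b = colorSet ω' b := fun h => by
    ext v; simp [colorSet, h v]
  have hmem : ∀ {ω : V → κ} {b : κ} {v : V}, v ∈ colorSet ω b ↔ ω v = b := by
    simp [colorSet]
  have inv₂ : ∀ ω ω' : V → κ, (∀ v, ω v = c₁ ↔ ω' v = c₁) → H₂ ω = H₂ ω' := fun ω ω' h => by
    simp only [H₂, A₁, hcol h]
  have inv₃ : ∀ ω ω' : V → κ, (∀ v, ω v = c₁ ↔ ω' v = c₁) → (∀ v, ω v = c₂ ↔ ω' v = c₂) →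
      H₃ ω = H₃ ω' := fun ω ω' h h' => by
    simp only [H₃, A₂, inv₂ ω ω' h, hcol h']
  have avoid₂ : ∀ ω, ∀ S ∈ H₂ ω, ∀ v ∈ S, ω v ≠ c₁ := by
    intro ω S hS v hv hv1
    obtain ⟨R, -, hR⟩ := exists_eq_sdiff_of_mem_fragments (Finset.mem_filter.1 hS).1
    rw [← hR] at hv
    exact (Finset.mem_sdiff.1 hv).2 (hmem.2 hv1)
  have avoid₃ : ∀ ω, ∀ S ∈ H₃ ω, ∀ v ∈ S, ω v ≠ c₁ ∧ ω v ≠ c₂ := by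
    intro ω S hS v hv
    obtain ⟨R, hRH, hR⟩ := exists_eq_sdiff_of_mem_fragments (Finset.mem_filter.1 hS).1
    rw [← hR] at hv
    exact ⟨avoid₂ ω R hRH v (Finset.mem_sdiff.1 hv).1,
      fun h => (Finset.mem_sdiff.1 hv).2 (hmem.2 h)⟩
  have e₁ : ∑ ω : V → κ, ∑ T ∈ G₁ ω, q ^ T.card ≤ Fintype.card (V → κ) * Real.exp (-2) :=
    sum_large_fragments_le c₁ ∅ (by simp) (fun _ => H) (fun _ _ _ => rfl) (by simp) hq.le ht1
      (fun _ => hcard) hℓ.le (by rw [hqs])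
  have e₂ : ∑ ω : V → κ, ∑ T ∈ G₂ ω, q ^ T.card ≤ Fintype.card (V → κ) * Real.exp (-2) :=
    sum_large_fragments_le c₂ {c₁} (by simpa using h₁₂.symm) H₂
      (fun ω ω' h => inv₂ ω ω' fun v => h v c₁ (by simp)) (by simpa using avoid₂) hq.le ht2
      (fun ω S hS => (Finset.mem_filter.1 hS).2.le) (by positivity) (by rw [hqs])
  have e₃ : ∑ ω : V → κ, ∑ T ∈ G₃ ω, q ^ T.card ≤ Fintype.card (V → κ) * Real.exp (-2) :=
    sum_large_fragments_le c₃ {c₁, c₂} (by simpa using ⟨h₁₃.symm, h₂₃.symm⟩) H₃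
      (fun ω ω' h => inv₃ ω ω' (fun v => h v c₁ (by simp)) fun v => h v c₂ (by simp))
      (by simpa using avoid₃) hq.le le_rfl
      (fun ω S hS => (Finset.mem_filter.1 hS).2.le) (by positivity) (by rw [hqs, ht3])
  set Ω := Finset.univ.filter fun ω : V → κ =>
      ∀ S ∈ H, ¬ S ⊆ colorSet ω c₁ ∪ colorSet ω c₂ ∪ colorSet ω c₃ with hΩ
  have hN : 0 < (Fintype.card (V → κ) : ℝ) := by
    have : Nonempty (V → κ) := ⟨fun _ => c₁⟩
    exact_mod_cast Fintype.card_pos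
  have hrare' : (Fintype.card (V → κ) : ℝ) ≤ 2 * Ω.card := by exact_mod_cast hrare
  have hΩne : Ω.Nonempty := by
    rw [← Finset.card_pos]
    have : (0 : ℝ) < Ω.card := by linarith
    exact_mod_cast this
  -- Three rounds cost `3 * exp (-2) ≤ 1/2` on average over all colorings, hence at most 1 on
  -- average over `Ω`, which has at least half of them.
  have he : 6 * Real.exp (-2) ≤ 1 := by
    have h1 := Real.exp_one_gt_d9
    have h2 : Real.exp (-2) * (Real.exp 1 * Real.exp 1) = 1 := by
      rw [← Real.exp_add, ← Real.exp_add]; norm_num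
    have h3 := Real.exp_pos (-2)
    nlinarith
  obtain ⟨ω, hω, hle⟩ : ∃ ω ∈ Ω, (∑ T ∈ G₁ ω, q ^ T.card) + (∑ T ∈ G₂ ω, q ^ T.card) +
      (∑ T ∈ G₃ ω, q ^ T.card) ≤ 1 := by
    refine exists_mem_le_one_of_sum_le_card Ω hΩne (fun ω => by positivity) ?_
    simp only [Finset.sum_add_distrib]
    have h6 := mul_le_mul_of_nonneg_left he hN.le
    linarith
  have hω' : ∀ S ∈ H, ¬ S ⊆ colorSet ω c₁ ∪ colorSet ω c₂ ∪ colorSet ω c₃ :=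
    (Finset.mem_filter.1 hω).2
  clear e₁ e₂ e₃ inv₂ inv₃ avoid₂ avoid₃ hω
  refine ⟨G₁ ω ∪ G₂ ω ∪ G₃ ω, ?_, ?_, ?_⟩
  · have pos : ∀ (T : Finset V) {t : ℝ}, 1 ≤ t → t ≤ (T.card : ℝ) → T.Nonempty := by
      intro T t h h'
      rw [← Finset.card_pos]
      have : (0 : ℝ) < T.card := by linarith
      exact_mod_cast this
    intro T hT
    rcases Finset.mem_union.1 hT with hT | hT
    · rcases Finset.mem_union.1 hT with hT | hT
      · exact pos T ht1 (Finset.mem_filter.1 hT).2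
      · exact pos T ht2 (Finset.mem_filter.1 hT).2
    · exact pos T le_rfl (Finset.mem_filter.1 hT).2
  · intro S hS
    obtain ⟨T₁, hT₁, hTS₁⟩ := exists_fragment_subset (colorSet ω c₁) (Finset.mem_coe.1 hS)
    rcases le_or_gt (s * ℓ) T₁.card with h | h
    · exact ⟨T₁, Finset.mem_union_left _ (Finset.mem_union_left _ (Finset.mem_filter.2 ⟨hT₁, h⟩)),
        hTS₁⟩
    have hT₁' : T₁ ∈ H₂ ω := Finset.mem_filter.2 ⟨hT₁, h⟩
    obtain ⟨T₂, hT₂, hTS₂⟩ := exists_fragment_subset (colorSet ω c₂) hT₁'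
    rcases le_or_gt (s * (s * ℓ)) T₂.card with h | h
    · exact ⟨T₂, Finset.mem_union_left _ (Finset.mem_union_right _ (Finset.mem_filter.2 ⟨hT₂, h⟩)),
        hTS₂.trans hTS₁⟩
    have hT₂' : T₂ ∈ H₃ ω := Finset.mem_filter.2 ⟨hT₂, h⟩
    obtain ⟨T₃, hT₃, hTS₃⟩ := exists_fragment_subset (colorSet ω c₃) hT₂'
    rcases le_or_gt (1 : ℝ) T₃.card with h | h
    · exact ⟨T₃, Finset.mem_union_right _ (Finset.mem_filter.2 ⟨hT₃, h⟩),
        (hTS₃.trans hTS₂).trans hTS₁⟩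
    exfalso
    -- An empty last fragment would mean that a member of `H` lies in the three classes, contrary to
    -- the choice of `ω`.
    have h0 : T₃ = ∅ := by
      rw [← Finset.card_eq_zero]
      have : T₃.card < 1 := by exact_mod_cast h
      omega
    obtain ⟨R₂, hR₂, hR₂'⟩ := exists_eq_sdiff_of_mem_fragments hT₃
    obtain ⟨R₁, hR₁, hR₁'⟩ := exists_eq_sdiff_of_mem_fragments (Finset.mem_filter.1 hR₂).1
    obtain ⟨R, hR, hR'⟩ := exists_eq_sdiff_of_mem_fragments (Finset.mem_filter.1 hR₁).1
    refine hω' R hR ?_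
    rw [h0] at hR₂'
    subst hR' hR₁'
    intro a ha
    by_contra hna
    simp only [Finset.mem_union, not_or] at hna
    have : a ∈ ((R \ colorSet ω c₁) \ colorSet ω c₂) \ colorSet ω c₃ := by
      simp only [Finset.mem_sdiff]; tauto
    rw [hR₂'] at this
    simp at this
  · refine le_trans (sum_union_le_add _ _ fun T => by positivity) (le_trans ?_ hle)
    gcongr
    exact sum_union_le_add _ _ fun T => by positivity

/-- The density at which one of two cross-intersecting families of `k`-sets has a cheap cover. -/
noncomputable def coverDensity (k : ℕ) : ℝ := (k : ℝ) ^ (-(1 / 3) : ℝ) / (6 * Real.exp 3)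

theorem coverDensity_pos {k : ℕ} (hk : 0 < k) : 0 < coverDensity k := by
  have : (0 : ℝ) < k := by exact_mod_cast hk
  unfold coverDensity
  positivity

/-- Color the points with six colors. A member of `G` in the first three classes and a member of `H`
in the last three would be disjoint, so in every coloring one side contains no member. One of the
two families is therefore absent in at least half of the colorings. -/
theorem isCheap_or_isCheap_of_cross_intersecting {k : ℕ} (hk : 0 < k)
    {G H : Set (Finset V)} (hG : ∀ A ∈ G, A.card ≤ k) (hH : ∀ A ∈ H, A.card ≤ k)
    (hGH : ∀ A ∈ G, ∀ B ∈ H, (A ∩ B).Nonempty) :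
    IsCheap (coverDensity k) 1 G ∨ IsCheap (coverDensity k) 1 H := by
  classical
  have hk0 : (0 : ℝ) < k := by exact_mod_cast hk
  have hk1 : (1 : ℝ) ≤ k := by exact_mod_cast hk
  set s : ℝ := (k : ℝ) ^ (-(1 / 3) : ℝ) with hs
  have hs0 : 0 < s := by positivity
  have hs1 : s ≤ 1 := Real.rpow_le_one_of_one_le_of_nonpos hk1 (by norm_num)
  have hs3 : s ^ 3 * (k : ℝ) = 1 := by
    rw [hs, ← Real.rpow_natCast, ← Real.rpow_mul hk0.le]
    norm_num
    rw [Real.rpow_neg_one]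
    exact inv_mul_cancel₀ hk0.ne'
  have hd : coverDensity k = s / (Fintype.card (Fin 6) * Real.exp 3) := by
    simp [coverDensity, hs]
  let G' : Finset (Finset V) := Finset.univ.filter (· ∈ G)
  let H' : Finset (Finset V) := Finset.univ.filter (· ∈ H)
  have hG' : (G' : Set (Finset V)) = G := by ext; simp [G']
  have hH' : (H' : Set (Finset V)) = H := by ext; simp [H']
  let P : Finset (V → Fin 6) := Finset.univ.filter fun ω =>
    ∀ S ∈ G', ¬ S ⊆ colorSet ω 0 ∪ colorSet ω 1 ∪ colorSet ω 2
  let Q : Finset (V → Fin 6) := Finset.univ.filter fun ω =>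
    ∀ S ∈ H', ¬ S ⊆ colorSet ω 3 ∪ colorSet ω 4 ∪ colorSet ω 5
  have hPQ : P ∪ Q = Finset.univ := by
    refine Finset.eq_univ_iff_forall.2 fun ω => ?_
    by_contra hω
    simp only [P, Q, Finset.mem_union, Finset.mem_filter, Finset.mem_univ, true_and, not_or] at hω
    push Not at hω
    obtain ⟨⟨A, hA, hA'⟩, B, hB, hB'⟩ := hω
    obtain ⟨v, hv⟩ := hGH A (by simpa [G'] using hA) B (by simpa [H'] using hB)
    have h1 := hA' (Finset.mem_inter.1 hv).1
    have h2 := hB' (Finset.mem_inter.1 hv).2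
    simp only [colorSet, Finset.mem_union, Finset.mem_filter, Finset.mem_univ, true_and] at h1 h2
    rcases h1 with (h1 | h1) | h1 <;> rcases h2 with (h2 | h2) | h2 <;>
      exact absurd (h1.symm.trans h2) (by decide)
  have hcount : Fintype.card (V → Fin 6) ≤ P.card + Q.card := by
    rw [← Finset.card_univ, ← hPQ]
    exact Finset.card_union_le _ _
  rcases le_total Q.card P.card with h | h
  · left
    rw [hd, ← hG']
    exact isCheap_of_rarely_contained G' hs0 hs1 hs3
      (fun S hS => by exact_mod_cast hG S (by simpa [G'] using hS))
      (c₁ := 0) (c₂ := 1) (c₃ := 2) (by decide) (by decide) (by decide)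
      (hcount.trans (by simp only [P] at h ⊢; omega))
  · right
    rw [hd, ← hH']
    exact isCheap_of_rarely_contained H' hs0 hs1 hs3
      (fun S hS => by exact_mod_cast hH S (by simpa [H'] using hS))
      (c₁ := 3) (c₂ := 4) (c₃ := 5) (by decide) (by decide) (by decide)
      (hcount.trans (by simp only [Q] at h ⊢; omega))

end Cheap

/-! ### Centres of intersecting families -/

section Structure

variable {V : Type*}

/-- Lowering the density from `q` to `p` multiplies the weight of `T` by `(p / q) ^ |T|`. -/
theorem isCheap_of_large {p q : ℝ} (hp : 0 ≤ p) (hq : 0 < q) (hpq : p ≤ q)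
    {𝒢 : Finset (Finset V)} (h : ∑ T ∈ 𝒢, q ^ T.card ≤ 1) :
    IsCheap p ((p / q) ^ 2) {A : Finset V | ∃ T ∈ 𝒢, 2 ≤ T.card ∧ T ⊆ A} := by
  refine ⟨𝒢.filter (2 ≤ ·.card), ?_, ?_, ?_⟩
  · intro T hT
    rw [← Finset.card_pos]
    have := (Finset.mem_filter.1 hT).2
    omega
  · rintro A ⟨T, hT, h2, hTA⟩
    exact ⟨T, Finset.mem_filter.2 ⟨hT, h2⟩, hTA⟩
  · calc ∑ T ∈ 𝒢.filter (2 ≤ ·.card), p ^ T.card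
        ≤ ∑ T ∈ 𝒢.filter (2 ≤ ·.card), (p / q) ^ 2 * q ^ T.card := by
          refine Finset.sum_le_sum fun T hT => ?_
          calc p ^ T.card = (p / q) ^ T.card * q ^ T.card := by
                rw [← mul_pow, div_mul_cancel₀ _ hq.ne']
            _ ≤ _ := by
                gcongr ?_ * _
                exact pow_le_pow_of_le_one (by positivity) ((div_le_one hq).2 hpq)
                  (Finset.mem_filter.1 hT).2
      _ ≤ ∑ T ∈ 𝒢, (p / q) ^ 2 * q ^ T.card :=
          Finset.sum_le_sum_of_subset_of_nonneg (Finset.filter_subset _ _)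
            fun _ _ _ => by positivity
      _ ≤ (p / q) ^ 2 := by
          rw [← Finset.mul_sum]
          exact mul_le_of_le_one_right (by positivity) h

variable [DecidableEq V]

theorem isCheap_of_pairs (p : ℝ) (X : Finset V) :
    IsCheap p ((X.card * p) ^ 2)
      {A : Finset V | ∃ x ∈ X, ∃ y ∈ X, x ≠ y ∧ x ∈ A ∧ y ∈ A} := by
  refine ⟨X.powersetCard 2, ?_, ?_, ?_⟩
  · intro T hT
    rw [← Finset.card_pos, (Finset.mem_powersetCard.1 hT).2]
    norm_num
  · rintro A ⟨x, hx, y, hy, hxy, hxA, hyA⟩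
    refine ⟨{x, y}, Finset.mem_powersetCard.2 ⟨?_, Finset.card_pair hxy⟩, ?_⟩ <;>
      simp [Finset.insert_subset_iff, *]
  · rw [Finset.sum_congr rfl fun T hT => by rw [(Finset.mem_powersetCard.1 hT).2],
      Finset.sum_const, Finset.card_powersetCard, nsmul_eq_mul, mul_pow]
    gcongr
    exact_mod_cast Nat.choose_le_pow _ _

variable [Fintype V]

/-- An intersecting family of sets of size at most `k` has a cheap cover, up to the sets through
a suitable point. -/
theorem isCheap_or_exists_center {k : ℕ} (hk : 0 < k) {F : Set (Finset V)}
    (hF : ∀ A ∈ F, A.card ≤ k) (hint : ∀ A ∈ F, ∀ B ∈ F, (A ∩ B).Nonempty) {p : ℝ}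
    (hp : 0 ≤ p) (hpq : p ≤ coverDensity k) :
    IsCheap p (3 * (p / coverDensity k) ^ 2) F ∨
      ∃ x, IsCheap p (3 * (p / coverDensity k) ^ 2) {A ∈ F | x ∉ A} := by
  classical
  have hq := coverDensity_pos hk
  set q := coverDensity k
  obtain ⟨𝒢, hne, hcov, hsum⟩ : IsCheap q 1 F := by
    simpa using isCheap_or_isCheap_of_cross_intersecting hk hF hF hint
  set X : Finset V := Finset.univ.filter fun x => {x} ∈ 𝒢 with hX
  have hXq : X.card * q ≤ 1 := by
    calc X.card * q = ∑ T ∈ X.image (fun x => ({x} : Finset V)), q ^ T.card := by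
          rw [Finset.sum_image fun x _ y _ h => Finset.singleton_injective h]
          simp
      _ ≤ ∑ T ∈ 𝒢, q ^ T.card := by
          refine Finset.sum_le_sum_of_subset_of_nonneg ?_ fun _ _ _ => by positivity
          intro T hT
          obtain ⟨x, hx, rfl⟩ := Finset.mem_image.1 hT
          exact (Finset.mem_filter.1 hx).2
      _ ≤ 1 := hsum
  have hXp : X.card * p ≤ p / q := by
    rw [le_div_iff₀ hq]
    nlinarith
  let S : V → Set (Finset V) := fun x => {A ∈ F | A ∩ X = {x}}
  have hxS : ∀ x, ∀ A ∈ S x, x ∈ A ∧ x ∈ X := fun x A hA => by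
    have : x ∈ A ∩ X := by rw [hA.2]; simp
    exact Finset.mem_inter.1 this
  let good : V → Prop := fun x => IsCheap q 1 ((fun A : Finset V => A.erase x) '' S x)
  -- Three covers of cost at most `(p / q)^2` each: the large sets of `𝒢`, the pairs inside `X`,
  -- and, for members meeting `X` in a single good point, the covers of their traces.
  have hgood : ∀ F' ⊆ F, (∀ x, ∀ A ∈ F', A ∈ S x → good x) →
      IsCheap p (3 * (p / q) ^ 2) F' := by
    intro F' hF' h
    have h1 := isCheap_of_large hp hq hpq hsum
    have h2 := isCheap_of_pairs p X
    have h3 : IsCheap p ((X.filter good).card * (p * (p / q)))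
        (⋃ x ∈ X.filter good, S x) :=
      IsCheap.biUnion hp _ fun x hx => IsCheap.of_erase hp hq hpq x (fun A hA => (hxS x A hA).1)
        (Finset.mem_filter.1 hx).2
    refine ((h1.union hp h2).union hp h3).mono ?_ ?_
    · intro A hA
      obtain ⟨T, hT, hTA⟩ := hcov A (hF' hA)
      rcases le_or_gt 2 T.card with hT2 | hT2
      · exact Or.inl (Or.inl ⟨T, hT, hT2, hTA⟩)
      have hT1 : T.card = 1 := by
        have := (hne T hT).card_pos
        omega
      obtain ⟨x, rfl⟩ := Finset.card_eq_one.1 hT1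
      have hxX : x ∈ X := by simpa [hX] using hT
      have hxA : x ∈ A := Finset.singleton_subset_iff.1 hTA
      by_cases hAx : A ∩ X = {x}
      · refine Or.inr (Set.mem_biUnion ?_ (⟨hF' hA, hAx⟩ : A ∈ S x))
        exact Finset.mem_coe.2 (Finset.mem_filter.2 ⟨hxX, h x A hA ⟨hF' hA, hAx⟩⟩)
      · refine Or.inl (Or.inr ?_)
        obtain ⟨y, hy, hyx⟩ : ∃ y ∈ A ∩ X, y ≠ x := by
          by_contra! hcon
          exact hAx (Finset.eq_singleton_iff_unique_mem.2
            ⟨Finset.mem_inter.2 ⟨hxA, hxX⟩, hcon⟩)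
        rw [Finset.mem_inter] at hy
        exact ⟨x, hxX, y, hy.2, hyx.symm, hxA, hy.1⟩
    · have h4 : ((X.filter good).card : ℝ) ≤ X.card := by
        exact_mod_cast Finset.card_filter_le _ _
      have h5 : ((X.filter good).card : ℝ) * (p * (p / q)) ≤ (p / q) ^ 2 := by
        calc ((X.filter good).card : ℝ) * (p * (p / q)) ≤ X.card * (p * (p / q)) := by gcongr
          _ = X.card * p * (p / q) := by ring
          _ ≤ (p / q) * (p / q) := by gcongr
          _ = _ := by ring
      have h6 : (X.card * p) ^ 2 ≤ (p / q) ^ 2 := by gcongr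
      linarith
  by_cases hall : ∀ x, good x
  · exact Or.inl (hgood F subset_rfl fun x _ _ _ => hall x)
  push Not at hall
  obtain ⟨x₀, hx₀⟩ := hall
  -- There is at most one bad point: members of `S x₀` and `S x` with `x ≠ x₀` can meet only outside
  -- `X`, so their traces cross-intersect and one side is cheap.
  refine Or.inr ⟨x₀, hgood _ (fun A hA => hA.1) fun x A hA hAx => ?_⟩
  have hne : x₀ ≠ x := by
    rintro rfl
    exact hA.2 (hxS _ A hAx).1
  refine (isCheap_or_isCheap_of_cross_intersecting hk ?_ ?_ ?_).resolve_left hx₀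
  · rintro _ ⟨A, hA, rfl⟩
    exact (Finset.card_le_card (Finset.erase_subset _ _)).trans (hF A hA.1)
  · rintro _ ⟨A, hA, rfl⟩
    exact (Finset.card_le_card (Finset.erase_subset _ _)).trans (hF A hA.1)
  · rintro _ ⟨A, hA, rfl⟩ _ ⟨B, hB, rfl⟩
    obtain ⟨z, hz⟩ := hint A hA.1 B hB.1
    obtain ⟨hzA, hzB⟩ := Finset.mem_inter.1 hz
    have hzX : z ∉ X := fun hzX => by
      have h1 : z ∈ A ∩ X := Finset.mem_inter.2 ⟨hzA, hzX⟩
      have h2 : z ∈ B ∩ X := Finset.mem_inter.2 ⟨hzB, hzX⟩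
      rw [hA.2, Finset.mem_singleton] at h1
      rw [hB.2, Finset.mem_singleton] at h2
      exact hne (h1.symm.trans h2)
    refine ⟨z, Finset.mem_inter.2 ⟨Finset.mem_erase.2 ⟨?_, hzA⟩, Finset.mem_erase.2 ⟨?_, hzB⟩⟩⟩
    · rintro rfl
      exact hzX (hxS _ A hA).2
    · rintro rfl
      exact hzX (hxS _ B hB).2

/-- Every member of a non-trivial intersecting family contains one of at most `k` pairs, or one of
the sets of a cheap cover. -/
theorem IsNontrivialIntersecting.exists_cover {k : ℕ} (hk : 0 < k) {F : Set (Finset V)}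
    (hF : IsNontrivialIntersecting k F) {p : ℝ} (hp : 0 ≤ p) (hpq : p ≤ coverDensity k) :
    ∃ (E : Finset (V × V)) (𝒢 : Finset (Finset V)), E.card ≤ k ∧ (∀ e ∈ E, e.1 ≠ e.2) ∧
      (∀ T ∈ 𝒢, T.Nonempty) ∧ ∑ T ∈ 𝒢, p ^ T.card ≤ 3 * (p / coverDensity k) ^ 2 ∧
      ∀ A ∈ F, (∃ e ∈ E, e.1 ∈ A ∧ e.2 ∈ A) ∨ ∃ T ∈ 𝒢, T ⊆ A := by
  have hcard : ∀ A ∈ F, A.card = k := fun A hA => Set.powersetCard.mem_iff.1 (hF.sized hA)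
  rcases isCheap_or_exists_center hk (fun A hA => (hcard A hA).le) hF.intersecting hp hpq with
    ⟨𝒢, h1, h2, h3⟩ | ⟨x, 𝒢, h1, h2, h3⟩
  · exact ⟨∅, 𝒢, by simp, by simp, h1, h3, fun A hA => Or.inr (h2 A hA)⟩
  · obtain ⟨B, hB, hxB⟩ : ∃ B ∈ F, x ∉ B := by
      by_contra! h
      exact hF.not_isStar ⟨x, h⟩
    refine ⟨B.image (fun b => (x, b)), 𝒢, Finset.card_image_le.trans (hcard B hB).le, ?_, h1, h3,
      fun A hA => ?_⟩
    · intro e he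
      obtain ⟨b, hb, rfl⟩ := Finset.mem_image.1 he
      exact fun h : x = b => hxB (h ▸ hb)
    · by_cases hxA : x ∈ A
      · left
        obtain ⟨b, hb⟩ := hF.intersecting A hA B hB
        obtain ⟨hbA, hbB⟩ := Finset.mem_inter.1 hb
        exact ⟨(x, b), Finset.mem_image_of_mem _ hbB, hxA, hbA⟩
      · exact Or.inr (h2 A ⟨hA, hxA⟩)

end Structure

/-! ### Independent sets in a random subset -/

section RandomSubset

variable {V : Type*} [DecidableEq V] [Fintype V] {κ : Type*} [Fintype κ] [DecidableEq κ]

/-- A color class of a uniform coloring serves as a finite model of a random subset, which restricts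
the densities to reciprocals of integers. -/
theorem sum_indicator_subset_colorSet (c : κ) (T : Finset V) :
    ∑ ω : V → κ, (if T ⊆ colorSet ω c then (1 : ℝ) else 0) =
      Fintype.card (V → κ) * ((Fintype.card κ : ℝ)⁻¹) ^ T.card := by
  have hκ : (Fintype.card κ : ℝ) ≠ 0 := by
    have : Nonempty κ := ⟨c⟩
    exact_mod_cast Fintype.card_ne_zero
  have h1 : (Finset.univ.filter fun ω : V → κ => T ⊆ colorSet ω c) =
      Fintype.piFinset fun v => if v ∈ T then {c} else Finset.univ := by
    ext ω
    simp only [Finset.mem_filter, Finset.mem_univ, true_and, Fintype.mem_piFinset]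
    refine ⟨fun h v => ?_, fun h v hv => ?_⟩
    · by_cases hv : v ∈ T
      · simpa [hv, colorSet] using h hv
      · simp [hv]
    · simpa [hv, colorSet] using h v
  have h2 : ∀ v, (((if v ∈ T then {c} else Finset.univ : Finset κ).card : ℕ) : ℝ) =
      Fintype.card κ * if v ∈ T then (Fintype.card κ : ℝ)⁻¹ else 1 := by
    intro v
    split_ifs
    · simp [hκ]
    · simp
  rw [Finset.sum_boole, h1, Fintype.card_piFinset, Nat.cast_prod,
    Finset.prod_congr rfl fun v _ => h2 v, Finset.prod_mul_distrib]
  congr 1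
  · simp
  · rw [Finset.prod_ite]
    simp

/-- A graph with few adjacent pairs has a large independent set which contains no member of a
given cheap collection of nonempty sets. -/
theorem exists_independent_avoiding [Nonempty κ] (r : V → V → Prop) [DecidableRel r]
    (hr : ∀ u v, r u v → r v u) (hi : ∀ v, ¬ r v v) (𝒢 : Finset (Finset V))
    (h𝒢 : ∀ T ∈ 𝒢, T.Nonempty) {D : ℝ} (hD : 0 ≤ D) :
    ∃ I : Finset V, (∀ u ∈ I, ∀ v ∈ I, ¬ r u v) ∧ (∀ T ∈ 𝒢, ¬ T ⊆ I) ∧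
      (1 + 2 * D) * (Fintype.card V * (Fintype.card κ : ℝ)⁻¹ -
        ∑ T ∈ 𝒢, ((Fintype.card κ : ℝ)⁻¹) ^ T.card) -
        (∑ u, ((Finset.univ.filter (r u)).card : ℝ)) * ((Fintype.card κ : ℝ)⁻¹) ^ 2 ≤
      (1 + D) ^ 2 * I.card := by
  classical
  obtain ⟨c⟩ := ‹Nonempty κ›
  set p : ℝ := (Fintype.card κ : ℝ)⁻¹ with hp
  let ind : (V → κ) → Finset V → ℝ := fun ω T => if T ⊆ colorSet ω c then 1 else 0
  have hind : ∀ T, ∑ ω, ind ω T = Fintype.card (V → κ) * p ^ T.card :=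
    fun T => sum_indicator_subset_colorSet c T
  let f : (V → κ) → ℝ := fun ω => (1 + 2 * D) * (∑ v, ind ω {v} - ∑ T ∈ 𝒢, ind ω T) -
    ∑ u, ∑ v ∈ Finset.univ.filter (r u), ind ω {u, v}
  set avg := (1 + 2 * D) * (Fintype.card V * p - ∑ T ∈ 𝒢, p ^ T.card) -
        (∑ u, ((Finset.univ.filter (r u)).card : ℝ)) * p ^ 2 with havg
  have hsum : ∑ ω, f ω = Fintype.card (V → κ) * avg := by
    simp only [f, Finset.sum_sub_distrib, ← Finset.mul_sum]
    rw [Finset.sum_comm (t := (Finset.univ : Finset V)), Finset.sum_comm (t := 𝒢),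
      Finset.sum_comm (t := (Finset.univ : Finset V))]
    have h1 : ∀ u : V, ∑ ω, ∑ v ∈ Finset.univ.filter (r u), ind ω {u, v} =
        Fintype.card (V → κ) * (((Finset.univ.filter (r u)).card : ℝ) * p ^ 2) := by
      intro u
      rw [Finset.sum_comm]
      have : ∀ v ∈ Finset.univ.filter (r u), ∑ ω, ind ω {u, v} =
          Fintype.card (V → κ) * p ^ 2 := by
        intro v hv
        have huv : u ≠ v := by
          rintro rfl
          exact hi _ (Finset.mem_filter.1 hv).2
        rw [hind, Finset.card_pair huv]
      rw [Finset.sum_congr rfl this, Finset.sum_const, nsmul_eq_mul]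
      ring
    simp only [h1, hind, ← Finset.mul_sum, Finset.card_singleton, Finset.sum_const,
      Finset.card_univ, nsmul_eq_mul, ← Finset.sum_mul, havg]
    ring
  obtain ⟨ω, -, hω⟩ : ∃ ω ∈ (Finset.univ : Finset (V → κ)), avg ≤ f ω := by
    refine Finset.exists_le_of_sum_le ⟨fun _ => c, Finset.mem_univ _⟩ ?_
    rw [hsum, Finset.sum_const, nsmul_eq_mul, Finset.card_univ]
  set W := colorSet ω c with hW
  let bad := 𝒢.filter (· ⊆ W)
  -- Alteration: delete one point from each set of `𝒢` that fell inside `W`.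
  choose pt hpt using h𝒢
  let del : Finset V := bad.attach.image fun T => pt T.1 (Finset.mem_filter.1 T.2).1
  have hdel : del.card ≤ bad.card := Finset.card_image_le.trans (by simp)
  obtain ⟨I, hI, hind', hcard⟩ := exists_independent_subset r hr hi D (W \ del)
  refine ⟨I, hind', fun T hT hTI => ?_, hω.trans (le_trans ?_ hcard)⟩
  · have hTb : T ∈ bad :=
      Finset.mem_filter.2 ⟨hT, hTI.trans (hI.trans Finset.sdiff_subset)⟩
    refine (Finset.mem_sdiff.1 (hI (hTI (hpt T hT)))).2 ?_
    exact Finset.mem_image.2 ⟨⟨T, hTb⟩, Finset.mem_attach _ _, rfl⟩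
  · have h1 : ∑ v, ind ω {v} = W.card := by
      simp [ind, hW]
    have h2 : ∑ T ∈ 𝒢, ind ω T = bad.card := by
      simp [ind, bad, hW, Finset.sum_boole]
    have h3 : (W.card : ℝ) - bad.card ≤ (W \ del).card := by
      have : W.card ≤ (W \ del).card + del.card := by
        have := Finset.le_card_sdiff del W
        omega
      have h' : (W.card : ℝ) ≤ (W \ del).card + bad.card := by
        exact_mod_cast this.trans (by omega)
      linarith
    have h4 : ∑ u ∈ W \ del, (((W \ del).filter (r u)).card : ℝ) ≤
        ∑ u, ∑ v ∈ Finset.univ.filter (r u), ind ω {u, v} := by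
      calc ∑ u ∈ W \ del, (((W \ del).filter (r u)).card : ℝ)
          ≤ ∑ u ∈ W \ del, ∑ v ∈ Finset.univ.filter (r u), ind ω {u, v} := by
            refine Finset.sum_le_sum fun u hu => ?_
            have hu' := (Finset.mem_sdiff.1 hu).1
            rw [Finset.sum_boole]
            refine Nat.cast_le.2 (Finset.card_le_card fun v hv => ?_)
            obtain ⟨hv, huv⟩ := Finset.mem_filter.1 hv
            have hv' := (Finset.mem_sdiff.1 hv).1
            simp [huv, Finset.insert_subset_iff, hu', hv', ← hW]
        _ ≤ _ := Finset.sum_le_sum_of_subset_of_nonneg (Finset.subset_univ _) fun u _ _ =>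
            Finset.sum_nonneg fun v _ => by simp only [ind]; split_ifs <;> norm_num
    simp only [f, h1, h2]
    have : (1 + 2 * D) * ((W.card : ℝ) - bad.card) ≤ (1 + 2 * D) * (W \ del).card := by gcongr
    linarith

end RandomSubset

/-! ### The covering criterion and the choice of density -/

/-- A criterion for `n` non-trivial intersecting families of `k`-sets not to cover all `k`-subsets
of an `n`-element set, in terms of the density `1 / m` of a random subset. -/
theorem not_exists_cover_of_density {n k m : ℕ} (hk : 0 < k) (hm : 0 < m)
    (hq : (m : ℝ)⁻¹ ≤ coverDensity k)
    (hn : (1 + 2 * k * (m : ℝ)⁻¹) ^ 2 * k ≤ n * ((1 + 2 * k * (m : ℝ)⁻¹) * (m : ℝ)⁻¹ -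
      (1 + 2 * (2 * k * (m : ℝ)⁻¹)) * (3 * ((m : ℝ)⁻¹ / coverDensity k) ^ 2))) :
    ¬ ∃ F : Fin n → Set (Finset (Fin n)), (∀ i, IsNontrivialIntersecting k (F i)) ∧
      Set.powersetCard (Fin n) k ⊆ ⋃ i, F i := by
  classical
  rintro ⟨F, hF, hcov⟩
  set p : ℝ := (m : ℝ)⁻¹ with hp
  have hp0 : 0 < p := by positivity
  choose E 𝒢 hEk hEne h𝒢 hsum hEG using fun i => (hF i).exists_cover hk hp0.le hq
  set η : ℝ := 3 * (p / coverDensity k) ^ 2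
  -- The tangent point `D` is the expected degree sum bound `2nk p^2` divided by the expected order
  -- `np`.
  set D : ℝ := 2 * k * p with hD
  have hD0 : 0 ≤ D := by positivity
  let P : Finset (Fin n × Fin n) :=
    Finset.univ.biUnion fun i => E i ∪ (E i).image Prod.swap
  have hPE : ∀ {e}, e ∈ P ↔ ∃ i, e ∈ E i ∨ e.swap ∈ E i := by
    intro e
    simp only [P, Finset.mem_biUnion, Finset.mem_univ, true_and, Finset.mem_union,
      Finset.mem_image]
    refine exists_congr fun i => or_congr_right ⟨?_, fun h => ⟨_, h, Prod.swap_swap e⟩⟩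
    rintro ⟨e', he', rfl⟩
    simpa using he'
  have hPcard : P.card ≤ n * (2 * k) := by
    refine Finset.card_biUnion_le.trans ?_
    calc ∑ i : Fin n, (E i ∪ (E i).image Prod.swap).card ≤ ∑ _i : Fin n, 2 * k := by
          refine Finset.sum_le_sum fun i _ => (Finset.card_union_le _ _).trans ?_
          have h1 : ((E i).image Prod.swap).card ≤ (E i).card := Finset.card_image_le
          have h2 := hEk i
          omega
      _ = n * (2 * k) := by simp
  let r : Fin n → Fin n → Prop := fun u v => (u, v) ∈ P
  have hr : ∀ u v, r u v → r v u := by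
    intro u v h
    obtain ⟨i, hi⟩ := hPE.1 h
    exact hPE.2 ⟨i, hi.symm⟩
  have hirr : ∀ v, ¬ r v v := by
    intro v h
    obtain ⟨i, hi | hi⟩ := hPE.1 h <;> exact hEne i _ hi rfl
  have hdeg : ∑ u, ((Finset.univ.filter (r u)).card : ℝ) ≤ n * (2 * k) := by
    have : ∑ u, (Finset.univ.filter (r u)).card = P.card := by
      rw [Finset.card_eq_sum_card_fiberwise (f := Prod.fst) (t := Finset.univ)
        (fun _ _ => by simp)]
      refine Finset.sum_congr rfl fun u _ => ?_
      refine Finset.card_bij (fun v _ => (u, v)) ?_ ?_ ?_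
      · intro v hv
        simpa [r] using hv
      · intro v _ w _ h
        exact (Prod.ext_iff.1 h).2
      · rintro ⟨a, b⟩ h
        obtain ⟨h1, h2⟩ := Finset.mem_filter.1 h
        obtain rfl : a = u := h2
        exact ⟨b, by simpa [r] using h1, rfl⟩
    exact_mod_cast this.le.trans hPcard
  let 𝒢' : Finset (Finset (Fin n)) := Finset.univ.biUnion 𝒢
  have hsum' : ∑ T ∈ 𝒢', p ^ T.card ≤ n * η := by
    simpa using sum_biUnion_le_card_mul Finset.univ 𝒢 (f := fun T => p ^ T.card)
      (fun T => by positivity) fun i _ => hsum i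
  have : Nonempty (Fin m) := ⟨⟨0, hm⟩⟩
  obtain ⟨I, hI, hIG, hcard⟩ := exists_independent_avoiding (κ := Fin m) r hr hirr 𝒢'
    (fun T hT => by
      obtain ⟨i, -, hi⟩ := Finset.mem_biUnion.1 hT
      exact h𝒢 i T hi) hD0
  simp only [Fintype.card_fin, ← hp] at hcard
  have hkI : k ≤ I.card := by
    have h1 : (1 + 2 * D) * (n * p - n * η) - n * (2 * k) * p ^ 2 ≤ (1 + D) ^ 2 * I.card := by
      refine le_trans (sub_le_sub (mul_le_mul_of_nonneg_left ?_ (by positivity))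
        (mul_le_mul_of_nonneg_right hdeg (by positivity))) hcard
      linarith
    have h2 : (1 + D) ^ 2 * k ≤ (1 + D) ^ 2 * I.card := by
      refine hn.trans (le_trans (le_of_eq ?_) h1)
      rw [hD]
      ring
    exact_mod_cast le_of_mul_le_mul_left h2 (by positivity)
  obtain ⟨A, hAI, hAk⟩ := Finset.exists_subset_card_eq hkI
  obtain ⟨i, hi⟩ := Set.mem_iUnion.1 (hcov (Set.powersetCard.mem_iff.2 hAk))
  rcases hEG i A hi with ⟨e, he, h1, h2⟩ | ⟨T, hT, hTA⟩
  · exact hI e.1 (hAI h1) e.2 (hAI h2) (hPE.2 ⟨i, Or.inl he⟩)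
  · exact hIG T (Finset.mem_biUnion.2 ⟨i, Finset.mem_univ _, hT⟩) (hTA.trans hAI)

open Filter Topology in
theorem eventually_density_estimates :
    ∀ᶠ k : ℕ in atTop, ∃ m : ℕ, 0 < m ∧ 1 ≤ Real.log k ∧ Real.log k ≤ k * (m : ℝ)⁻¹ ∧
      (m : ℝ)⁻¹ ≤ coverDensity k ∧
      k * (3 * ((m : ℝ)⁻¹ / coverDensity k) ^ 2) ≤ 1 / 8 := by
  have hlog : Tendsto (fun k : ℕ => Real.log k) atTop atTop :=
    Real.tendsto_log_atTop.comp tendsto_natCast_atTop_atTop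
  have h1 := (Real.isLittleO_log_id_atTop.comp_tendsto tendsto_natCast_atTop_atTop).def
    (show (0 : ℝ) < 1 / 2 by norm_num)
  set C : ℝ := 3 * (2 * (6 * Real.exp 3)) ^ 2 with hC
  have hC0 : 0 < C := by positivity
  have h2 := ((isLittleO_log_rpow_rpow_atTop (s := (1 : ℝ) / 3) 2
    (by norm_num)).comp_tendsto tendsto_natCast_atTop_atTop).def
    (show (0 : ℝ) < 1 / (8 * C) by positivity)
  filter_upwards [hlog.eventually_ge_atTop 1, h1, h2, eventually_ge_atTop 1] with k hL hk1 hk2 hk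
  have hk0 : (0 : ℝ) < k := by exact_mod_cast hk
  have hk1' : (1 : ℝ) ≤ k := by exact_mod_cast hk
  set L := Real.log k with hLdef
  have hL0 : 0 < L := by linarith
  simp only [Function.comp, id, Real.norm_eq_abs, abs_of_pos hk0, ← hLdef, abs_of_pos hL0] at hk1
  have hx : 2 ≤ k / L := by
    rw [le_div_iff₀ hL0]; linarith
  have hk2' : L ^ 2 ≤ 1 / (8 * C) * (k : ℝ) ^ ((1 : ℝ) / 3) := by
    have h : ‖(k : ℝ) ^ ((1 : ℝ) / 3)‖ = (k : ℝ) ^ ((1 : ℝ) / 3) :=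
      Real.norm_of_nonneg (by positivity)
    simp only [Function.comp, h, ← hLdef] at hk2
    refine le_trans ?_ hk2
    rw [Real.norm_of_nonneg (by positivity)]
    exact le_of_eq (by norm_cast)
  -- With this `m`, the quantity `k / m` lies between `ln k` and `2 ln k`, so the last estimate
  -- reduces to `C (ln k)^2 ≤ k^(1/3) / 8`.
  refine ⟨⌊(k : ℝ) / L⌋₊, Nat.floor_pos.2 (by linarith), hL, ?_⟩
  set M : ℝ := (⌊(k : ℝ) / L⌋₊ : ℝ) with hM
  have hM1 : M ≤ k / L := Nat.floor_le (by positivity)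
  have hM2 : k / L < M + 1 := Nat.lt_floor_add_one _
  have hM3 : k / L ≤ 2 * M := by linarith
  have hM0 : 0 < M := by linarith
  have hU1 : L ≤ k * M⁻¹ := by
    rw [← div_eq_mul_inv, le_div_iff₀ hM0]
    calc L * M ≤ L * (k / L) := by gcongr
      _ = k := by field_simp
  have hU2 : k * M⁻¹ ≤ 2 * L := by
    rw [← div_eq_mul_inv, div_le_iff₀ hM0]
    rw [div_le_iff₀ hL0] at hM3
    linarith
  have hq := coverDensity_pos hk
  have hmain : k * (3 * (M⁻¹ / coverDensity k) ^ 2) ≤ 1 / 8 := by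
    set t : ℝ := (k : ℝ) ^ ((1 : ℝ) / 3) with ht
    have ht0 : 0 < t := by positivity
    have ht3 : t ^ 3 = k := by
      rw [ht, ← Real.rpow_natCast, ← Real.rpow_mul hk0.le]; norm_num
    have hcd : coverDensity k = t⁻¹ / (6 * Real.exp 3) := by
      rw [coverDensity, Real.rpow_neg hk0.le, ht]
    have h3 : (k * M⁻¹) ^ 2 ≤ (2 * L) ^ 2 := by gcongr
    have h4 : k * (3 * (M⁻¹ / coverDensity k) ^ 2) =
        3 * (6 * Real.exp 3) ^ 2 * (k * M⁻¹) ^ 2 / t := by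
      rw [hcd, ← ht3]
      field_simp
    rw [h4, div_le_iff₀ ht0]
    calc 3 * (6 * Real.exp 3) ^ 2 * (k * M⁻¹) ^ 2 ≤ 3 * (6 * Real.exp 3) ^ 2 * (2 * L) ^ 2 := by
          gcongr
      _ = C * L ^ 2 := by rw [hC]; ring
      _ ≤ C * (1 / (8 * C) * t) := by gcongr
      _ = 1 / 8 * t := by field_simp
  refine ⟨hU1, ?_, hmain⟩
  have h5 : (M⁻¹ / coverDensity k) ^ 2 ≤ 1 := by
    have : (M⁻¹ / coverDensity k) ^ 2 ≤ k * (M⁻¹ / coverDensity k) ^ 2 :=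
      le_mul_of_one_le_left (by positivity) hk1'
    linarith
  have h6 : M⁻¹ / coverDensity k ≤ 1 := by
    have : 0 ≤ M⁻¹ / coverDensity k := by positivity
    nlinarith
  exact (div_le_one hq).1 h6

theorem eventually_not_exists_cover :
    ∀ᶠ k : ℕ in Filter.atTop, ∀ n : ℕ,
      (2 + 3 / Real.log (k : ℝ)) * (k : ℝ) ^ 2 ≤ (n : ℝ) →
        ¬ ∃ F : Fin n → Set (Finset (Fin n)),
          (∀ i, IsNontrivialIntersecting k (F i)) ∧
            Set.powersetCard (Fin n) k ⊆ ⋃ i, F i := by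
  filter_upwards [eventually_density_estimates, Filter.eventually_gt_atTop 0] with
    k ⟨m, hm, hL, hU, hq, hη⟩ hk n hn
  refine not_exists_cover_of_density hk hm hq ?_
  have hk0 : (0 : ℝ) < k := by exact_mod_cast hk
  set L := Real.log k
  set p : ℝ := (m : ℝ)⁻¹
  set η := 3 * (p / coverDensity k) ^ 2 with hηdef
  have hη0 : 0 ≤ η := by positivity
  have hL0 : 0 < L := by linarith
  obtain ⟨U, hUdef⟩ : ∃ U, U = k * p := ⟨_, rfl⟩
  obtain ⟨e, he⟩ : ∃ e, e = k * η := ⟨_, rfl⟩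
  rw [← hUdef] at hU
  rw [← he] at hη
  have he0 : 0 ≤ e := by rw [he]; positivity
  have hU0 : 0 < U := by linarith
  -- The term `3 U / L ≥ 3` pays for the missing 1 and for the error `4e + 6e / L ≤ 10 / 8`.
  have hkey : (1 + 2 * U) ≤ (2 + 3 / L) * (U - 2 * e) := by
    have h1 : 3 ≤ 3 / L * U := by
      rw [div_mul_eq_mul_div, le_div_iff₀ hL0]; linarith
    have h2 : 3 / L * e ≤ 3 * e := by
      gcongr
      exact div_le_self (by norm_num) hL
    nlinarith
  have hpos : 0 ≤ (1 + 2 * U) * (U - 2 * e) := by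
    apply mul_nonneg <;> linarith
  have hB : (1 + 2 * U) * (U - 2 * e) ≤
      k * ((1 + 2 * k * p) * p - (1 + 2 * (2 * k * p)) * η) := by
    have : k * ((1 + 2 * k * p) * p - (1 + 2 * (2 * k * p)) * η) =
        (1 + 2 * U) * U - (1 + 4 * U) * e := by rw [hUdef, he]; ring
    rw [this]
    nlinarith
  set Bk := (1 + 2 * k * p) * p - (1 + 2 * (2 * k * p)) * η with hBk
  have hB0 : 0 ≤ Bk := by
    by_contra h
    have : k * Bk < 0 := mul_neg_of_pos_of_neg hk0 (not_le.1 h)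
    linarith
  calc (1 + 2 * k * p) ^ 2 * k = (1 + 2 * U) * (1 + 2 * U) * k := by rw [hUdef]; ring
    _ ≤ (1 + 2 * U) * ((2 + 3 / L) * (U - 2 * e)) * k := by gcongr
    _ = (2 + 3 / L) * k * ((1 + 2 * U) * (U - 2 * e)) := by ring
    _ ≤ (2 + 3 / L) * k * (k * Bk) := by gcongr
    _ = (2 + 3 / L) * (k : ℝ) ^ 2 * Bk := by ring
    _ ≤ n * Bk := by gcongr

/-! ### Star-free colorings and the number `n(k)` -/

/-- Two disjoint halves of a ground set of size `2 * k` are told apart by the majority among three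
points. -/
theorem two_mul_mem_starFreeSizes {k : ℕ} (hk : 4 ≤ k) : 2 * k ∈ starFreeSizes k := by
  classical
  refine ⟨le_rfl, ?_⟩
  obtain ⟨T, -, hT⟩ := Finset.exists_subset_card_eq
    (s := (Finset.univ : Finset (Fin (2 * k)))) (n := 3)
    (by rw [Finset.card_univ, Fintype.card_fin]; omega)
  have hz : ∀ a : Fin (2 * k - 2 * k + 2), a = ⟨0, by omega⟩ ∨ a = ⟨1, by omega⟩ := by
    intro a
    have := a.2
    rcases Nat.lt_or_ge a.1 1 with h | h
    · exact Or.inl (Fin.ext (show a.1 = 0 by omega))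
    · exact Or.inr (Fin.ext (show a.1 = 1 by omega))
  let f : Set.powersetCard (Fin (2 * k)) k → Fin (2 * k - 2 * k + 2) := fun A =>
    if 2 ≤ ((A : Finset (Fin (2 * k))) ∩ T).card then ⟨1, by omega⟩ else ⟨0, by omega⟩
  have hf : ∀ {A B}, (kneserGraph (2 * k) k).Adj A B → f A ≠ f B := by
    rintro A B ⟨-, hAB⟩
    have hA : (A : Finset (Fin (2 * k))).card = k := Set.powersetCard.card_eq A
    have hB : (B : Finset (Fin (2 * k))).card = k := Set.powersetCard.card_eq B
    have huniv : (A : Finset (Fin (2 * k))) ∪ B = Finset.univ := by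
      rw [← Finset.card_eq_iff_eq_univ, Finset.card_union_of_disjoint hAB, hA, hB]
      rw [Fintype.card_fin, two_mul]
    have hsum : ((A : Finset (Fin (2 * k))) ∩ T).card + ((B : Finset (Fin (2 * k))) ∩ T).card
        = 3 := by
      rw [← Finset.card_union_of_disjoint
        (hAB.mono Finset.inter_subset_left Finset.inter_subset_left),
        ← Finset.union_inter_distrib_right, huniv, Finset.univ_inter, hT]
    simp only [f]
    split_ifs <;> simp <;> omega
  have hmem : ∀ (c : Fin (2 * k - 2 * k + 2)) (A : Finset (Fin (2 * k))) (hA : A.card = k),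
      f ⟨A, Set.powersetCard.mem_iff.2 hA⟩ = c →
      A ∈ colorFamily (SimpleGraph.Coloring.mk f hf) c := fun c A hA h => ⟨⟨A, _⟩, h, rfl⟩
  refine ⟨SimpleGraph.Coloring.mk f hf, fun c ⟨i, hi⟩ => ?_⟩
  rcases hz c with rfl | rfl
  · obtain ⟨A, hAs, hA⟩ := Finset.exists_subset_card_eq (s := (insert i T)ᶜ) (n := k) (by
      rw [Finset.card_compl, Fintype.card_fin]
      have := Finset.card_insert_le i T
      omega)
    have hAT : A ∩ T = ∅ := by
      refine Finset.disjoint_iff_inter_eq_empty.1 (Finset.disjoint_left.2 fun a ha haT => ?_)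
      exact (Finset.mem_compl.1 (hAs ha)) (Finset.mem_insert_of_mem haT)
    refine (Finset.mem_compl.1 (hAs (hi A (hmem _ A hA ?_)))) (Finset.mem_insert_self _ _)
    simp [f, hAT]
  · obtain ⟨R, hRT, hR⟩ := Finset.exists_subset_card_eq (s := T.erase i) (n := 2) (by
      have := Finset.pred_card_le_card_erase (s := T) (a := i)
      omega)
    have hRi : R ⊆ Finset.univ.erase i :=
      hRT.trans (Finset.erase_subset_erase _ (Finset.subset_univ _))
    obtain ⟨A, hRA, hAs, hA⟩ := Finset.exists_subsuperset_card_eq hRi (n := k) (by omega) (by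
      rw [Finset.card_erase_of_mem (Finset.mem_univ _), Finset.card_univ, Fintype.card_fin]
      omega)
    refine Finset.notMem_erase i _ (hAs (hi A (hmem _ A hA ?_)))
    have : 2 ≤ (A ∩ T).card := hR.symm.le.trans
      (Finset.card_le_card (Finset.subset_inter hRA (hRT.trans (Finset.erase_subset _ _))))
    simp [f, this]

/-- The color classes of a coloring without stars are `n` non-trivial intersecting families, if
some of them are repeated. -/
theorem exists_cover_of_mem_starFreeSizes {n k : ℕ} (hk : 0 < k) (h : n ∈ starFreeSizes k) :
    ∃ F : Fin n → Set (Finset (Fin n)), (∀ i, IsNontrivialIntersecting k (F i)) ∧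
      Set.powersetCard (Fin n) k ⊆ ⋃ i, F i := by
  obtain ⟨hn, C, hC⟩ := h
  let g : Fin n → Fin (n - 2 * k + 2) := fun i =>
    if h : i.1 < n - 2 * k + 2 then ⟨i.1, h⟩ else ⟨0, by omega⟩
  refine ⟨fun i => colorFamily C (g i), fun i => ⟨?_, ?_, hC _⟩, ?_⟩
  · rintro _ ⟨A, -, rfl⟩
    exact A.2
  · rintro _ ⟨A, hA, rfl⟩ _ ⟨B, hB, rfl⟩
    rw [← Finset.not_disjoint_iff_nonempty_inter]
    intro hAB
    refine C.valid (v := A) (w := B) ⟨?_, hAB⟩ (hA.trans hB.symm)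
    rintro rfl
    have h0 : (A : Finset (Fin n)) = ∅ := by simpa using hAB
    have hA' : (A : Finset (Fin n)).card = k := Set.powersetCard.card_eq A
    rw [h0, Finset.card_empty] at hA'
    omega
  · intro A hA
    have hlt : (C ⟨A, hA⟩).1 < n := lt_of_lt_of_le (C ⟨A, hA⟩).2 (by omega)
    refine Set.mem_iUnion.2 ⟨⟨(C ⟨A, hA⟩).1, hlt⟩, ⟨A, hA⟩, ?_, rfl⟩
    simp [g, SimpleGraph.Coloring.colorClass]

theorem theorem1p2 :
    ∀ᶠ k : ℕ in Filter.atTop,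
      (∀ n : ℕ, (2 + 3 / Real.log (k : ℝ)) * (k : ℝ) ^ 2 ≤ (n : ℝ) →
        ¬ ∃ F : Fin n → Set (Finset (Fin n)),
          (∀ i, IsNontrivialIntersecting k (F i)) ∧
            Set.powersetCard (Fin n) k ⊆ ⋃ i, F i) ∧
      IsGreatest (starFreeSizes k) (starFreeNumber k) ∧
      (starFreeNumber k : ℝ) < (2 + 3 / Real.log (k : ℝ)) * (k : ℝ) ^ 2 := by
  filter_upwards [eventually_not_exists_cover, Filter.eventually_ge_atTop 4] with k hcov hk
  have hlt : ∀ n ∈ starFreeSizes k,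
      (n : ℝ) < (2 + 3 / Real.log (k : ℝ)) * (k : ℝ) ^ 2 := fun n hn => by
    by_contra h
    exact hcov n (not_lt.1 h) (exists_cover_of_mem_starFreeSizes (by omega) hn)
  have hbdd : BddAbove (starFreeSizes k) :=
    ⟨⌈(2 + 3 / Real.log (k : ℝ)) * (k : ℝ) ^ 2⌉₊, fun n hn => by
      exact_mod_cast (hlt n hn).le.trans (Nat.le_ceil _)⟩
  -- Nonemptiness and boundedness make the supremum an attained maximum rather than a default value.
  have hmem : starFreeNumber k ∈ starFreeSizes k :=
    Nat.sSup_mem ⟨_, two_mul_mem_starFreeSizes hk⟩ hbdd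
  exact ⟨hcov, ⟨hmem, fun n hn => le_csSup hbdd hn⟩, hlt _ hmem⟩
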